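/- \textbf{Theorem (Strong duality).} Let $n,m,r$ be natural numbers, and let $\{w_k\}_{k\ge 0}$ be independent real square-integrable random variables on a probability space with $\mathcal E(w_k)=0$ and $\mathcal E(w_kw_s)=\delta_{ks}$. For real matrices $A,C\in\mathbb R^{n\times n}$, $B,D\in\mathbb R^{n\times m}$ consider the system $$x_{k+1}=Ax_k+Bu_k+(Cx_k+Du_k)w_k,\qquad x_0=z\in\mathbb R^n .$$ For $G,H\in\mathbb R^{n\times n}$, the system $x_{k+1}=Gx_k+Hx_kw_k$, written $[G;H]$, is called ASMS (asymptotically mean square stable) if $\lim_{k\to\infty}\mathcal E(x_k'x_k)=0$ for every deterministic initial state $x_0$. Let $\mathscr F=\{F\in\mathbb R^{m\times n}:[A+BF;\,C+DF]\text{ is ASMS}\}$. Let $Q\in\mathbb R^{n\times n}$ and $R\in\mathbb R^{m\times m}$ be symmetric. Assume: (1) $Q\succeq 0$ and $R\succ 0$; (2) $\mathscr F\neq\emptyset$ (stabilizability); (3) $(A,C|Q)$ is exactly observable or exactly detectable, i.e. there is an integer $T\ge 1$ such that for every $x_0\in\mathbb R^n$ the solution of $x_{k+1}=Ax_k+Cx_kw_k$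 with $Qx_k=0$ a.s. for all $k\in\{0,1,\dots,T\}$ satisfies $x_0=0$ (respectively $\lim_{k\to\infty}\mathcal E\|x_k\|^2=0$). Let $z_1,\dots,z_r\in\mathbb R^n$ be such that $Z:=\sum_{l=1}^r z_lz_l'\succ 0$. Put $$\Lambda=\begin{bmatrix}Q&0\\0&R\end{bmatrix},\quad A_F=\begin{bmatrix}A&B\\FA&FB\end{bmatrix},\quad C_F=\begin{bmatrix}C&D\\FC&FD\end{bmatrix}\qquad(F\in\mathbb R^{m\times n}),$$ and let $\mathscr S_{n+m}$ (resp. $\mathscr S_{n+m}^+$) be the set of real symmetric (resp. symmetric positive semidefinite) $(n+m)\times(n+m)$ matrices. The primal value is $$J_{\mathcal P_1}:=\inf\Big\{\mathrm{Tr}(\Lambda S): S\in\mathscr S_{n+m},\ F\in\mathscr F,\ A_FSA_F'+C_FSC_F'+\begin{bmatrix}I_n\\F\end{bmatrix}Z\begin{bmatrix}I_n\\F\end{bmatrix}'=S\Big\}.$$ With the Lagrangian $$L(X,F,S)=\mathrm{Tr}(\Lambda S)+\mathrm{Tr}\Big[\Big(A_FSA_F'+C_FSC_F'-S+\begin{bmatrix}I_n\\F\end{bmatrix}Z\begin{bmatrix}I_n\\F\end{bmatrix}'\Big)X\Big],$$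 the dual value is $$J_{\mathcal D}:=\sup_{X\in\mathscr S_{n+m}}\ \inf_{S\in\mathscr S_{n+m}^+,\ F\in\mathscr F}L(X,F,S).$$ Here infima and suprema are taken in $[-\infty,+\infty]$. Then $$J_{\mathcal P_1}=J_{\mathcal D}.$$ -/

import Mathlib

open MeasureTheory ProbabilityTheory Filter Topology Matrix

namespace SLQR

noncomputable section

/-- A sequence of real independent square integrable random variables with zero mean
and `E (w k * w s) = δ_{ks}`. -/
structure IsNoise {Ω : Type*} [MeasurableSpace Ω] (μ : Measure Ω) (w : ℕ → Ω → ℝ) : Prop where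
  measurable : ∀ k, Measurable (w k)
  memLp : ∀ k, MemLp (w k) 2 μ
  indep : iIndepFun w μ
  mean : ∀ k, ∫ ω, w k ω ∂μ = 0
  cov : ∀ k s, ∫ ω, w k ω * w s ω ∂μ = if k = s then 1 else 0

/-- The solution of `x (k+1) = A x k + (C x k) w k`, `x 0 = z`. -/
def traj {Ω : Type*} {n : ℕ} (w : ℕ → Ω → ℝ) (A C : Matrix (Fin n) (Fin n) ℝ)
    (z : Fin n → ℝ) : ℕ → Ω → Fin n → ℝ
  | 0 => fun _ => z
  | k + 1 => fun ω => A *ᵥ traj w A C z k ω + w k ω • (C *ᵥ traj w A C z k ω)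

/-- The mean square `E (x k' x k)` of the solution. -/
def meanSq {Ω : Type*} [MeasurableSpace Ω] {n : ℕ} (μ : Measure Ω) (w : ℕ → Ω → ℝ)
    (A C : Matrix (Fin n) (Fin n) ℝ) (z : Fin n → ℝ) (k : ℕ) : ℝ :=
  ∫ ω, traj w A C z k ω ⬝ᵥ traj w A C z k ω ∂μ

/-- `[A; C]` is asymptotically mean square stable. -/
def IsASMS {Ω : Type*} [MeasurableSpace Ω] {n : ℕ} (μ : Measure Ω) (w : ℕ → Ω → ℝ)
    (A C : Matrix (Fin n) (Fin n) ℝ) : Prop :=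
  ∀ z : Fin n → ℝ, Tendsto (meanSq μ w A C z) atTop (𝓝 0)

/-- The set of stabilizing state-feedback gains of `[A, B; C, D]`. -/
def stabGains {Ω : Type*} [MeasurableSpace Ω] {n m : ℕ} (μ : Measure Ω) (w : ℕ → Ω → ℝ)
    (A : Matrix (Fin n) (Fin n) ℝ) (B : Matrix (Fin n) (Fin m) ℝ)
    (C : Matrix (Fin n) (Fin n) ℝ) (D : Matrix (Fin n) (Fin m) ℝ) :
    Set (Matrix (Fin m) (Fin n) ℝ) :=
  {F | IsASMS μ w (A + B * F) (C + D * F)}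

/-- `[A, B; C, D]` is stabilizable. -/
def IsStabilizable {Ω : Type*} [MeasurableSpace Ω] {n m : ℕ} (μ : Measure Ω) (w : ℕ → Ω → ℝ)
    (A : Matrix (Fin n) (Fin n) ℝ) (B : Matrix (Fin n) (Fin m) ℝ)
    (C : Matrix (Fin n) (Fin n) ℝ) (D : Matrix (Fin n) (Fin m) ℝ) : Prop :=
  ∃ F : Matrix (Fin m) (Fin n) ℝ, IsASMS μ w (A + B * F) (C + D * F)

/-- The output `y k = Q x k` vanishes almost surely for all `k ∈ {0, 1, ..., T}`. -/
def OutputVanishes {Ω : Type*} [MeasurableSpace Ω] {n : ℕ} (μ : Measure Ω) (w : ℕ → Ω → ℝ)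
    (A C Q : Matrix (Fin n) (Fin n) ℝ) (T : ℕ) (z : Fin n → ℝ) : Prop :=
  ∀ k ≤ T, ∀ᵐ ω ∂μ, Q *ᵥ traj w A C z k ω = 0

/-- `(A, C | Q)` is exactly observable. -/
def IsExactlyObservable {Ω : Type*} [MeasurableSpace Ω] {n : ℕ} (μ : Measure Ω)
    (w : ℕ → Ω → ℝ) (A C Q : Matrix (Fin n) (Fin n) ℝ) : Prop :=
  ∃ T : ℕ, 0 < T ∧ ∀ z : Fin n → ℝ, OutputVanishes μ w A C Q T z → z = 0

/-- `(A, C | Q)` is exactly detectable. -/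
def IsExactlyDetectable {Ω : Type*} [MeasurableSpace Ω] {n : ℕ} (μ : Measure Ω)
    (w : ℕ → Ω → ℝ) (A C Q : Matrix (Fin n) (Fin n) ℝ) : Prop :=
  ∃ T : ℕ, 0 < T ∧ ∀ z : Fin n → ℝ, OutputVanishes μ w A C Q T z →
    Tendsto (meanSq μ w A C z) atTop (𝓝 0)

/-- `Z = ∑ l, z l (z l)'`. -/
def initGram {n r : ℕ} (z : Fin r → Fin n → ℝ) : Matrix (Fin n) (Fin n) ℝ :=
  ∑ l, vecMulVec (z l) (z l)

/-- `Λ = [Q 0; 0 R]`. -/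
def costMat {n m : ℕ} (Q : Matrix (Fin n) (Fin n) ℝ) (R : Matrix (Fin m) (Fin m) ℝ) :
    Matrix (Fin n ⊕ Fin m) (Fin n ⊕ Fin m) ℝ :=
  fromBlocks Q 0 0 R

/-- The augmented matrix `[A B; F A  F B]`. -/
def augMat {n m : ℕ} (A : Matrix (Fin n) (Fin n) ℝ) (B : Matrix (Fin n) (Fin m) ℝ)
    (F : Matrix (Fin m) (Fin n) ℝ) : Matrix (Fin n ⊕ Fin m) (Fin n ⊕ Fin m) ℝ :=
  fromBlocks A B (F * A) (F * B)

/-- `A_F S A_F' + C_F S C_F' + [I; F] Z [I; F]'`. -/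
def lyapRhs {n m : ℕ}
    (A : Matrix (Fin n) (Fin n) ℝ) (B : Matrix (Fin n) (Fin m) ℝ)
    (C : Matrix (Fin n) (Fin n) ℝ) (D : Matrix (Fin n) (Fin m) ℝ)
    (Z : Matrix (Fin n) (Fin n) ℝ) (F : Matrix (Fin m) (Fin n) ℝ)
    (S : Matrix (Fin n ⊕ Fin m) (Fin n ⊕ Fin m) ℝ) :
    Matrix (Fin n ⊕ Fin m) (Fin n ⊕ Fin m) ℝ :=
  augMat A B F * S * (augMat A B F)ᵀ + augMat C D F * S * (augMat C D F)ᵀ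
    + fromRows 1 F * Z * (fromRows 1 F)ᵀ

/-- The optimal value of the primal problem, an infimum in the extended reals: minimize
`Tr (Λ S)` over symmetric `S` and stabilizing `F` subject to the augmented generalized
Lyapunov equation. -/
def primalValue {Ω : Type*} [MeasurableSpace Ω] {n m : ℕ} (μ : Measure Ω) (w : ℕ → Ω → ℝ)
    (A : Matrix (Fin n) (Fin n) ℝ) (B : Matrix (Fin n) (Fin m) ℝ)
    (C : Matrix (Fin n) (Fin n) ℝ) (D : Matrix (Fin n) (Fin m) ℝ)
    (Q : Matrix (Fin n) (Fin n) ℝ) (R : Matrix (Fin m) (Fin m) ℝ)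
    (Z : Matrix (Fin n) (Fin n) ℝ) : EReal :=
  ⨅ (S : Matrix (Fin n ⊕ Fin m) (Fin n ⊕ Fin m) ℝ) (F : Matrix (Fin m) (Fin n) ℝ)
    (_ : S.IsSymm ∧ lyapRhs A B C D Z F S = S ∧ F ∈ stabGains μ w A B C D),
    (((costMat Q R * S).trace : ℝ) : EReal)

/-- The Lagrangian `L (X, F, S)` of the primal problem. -/
def lagrangian {n m : ℕ}
    (A : Matrix (Fin n) (Fin n) ℝ) (B : Matrix (Fin n) (Fin m) ℝ)
    (C : Matrix (Fin n) (Fin n) ℝ) (D : Matrix (Fin n) (Fin m) ℝ)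
    (Q : Matrix (Fin n) (Fin n) ℝ) (R : Matrix (Fin m) (Fin m) ℝ)
    (Z : Matrix (Fin n) (Fin n) ℝ)
    (X : Matrix (Fin n ⊕ Fin m) (Fin n ⊕ Fin m) ℝ) (F : Matrix (Fin m) (Fin n) ℝ)
    (S : Matrix (Fin n ⊕ Fin m) (Fin n ⊕ Fin m) ℝ) : ℝ :=
  (costMat Q R * S).trace + ((lyapRhs A B C D Z F S - S) * X).trace

/-- The Lagrangian dual function `d (X)`, the infimum of `L (X, F, S)` over positive
semidefinite `S` and stabilizing `F`; it may be `-∞`. -/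
def dualFun {Ω : Type*} [MeasurableSpace Ω] {n m : ℕ} (μ : Measure Ω) (w : ℕ → Ω → ℝ)
    (A : Matrix (Fin n) (Fin n) ℝ) (B : Matrix (Fin n) (Fin m) ℝ)
    (C : Matrix (Fin n) (Fin n) ℝ) (D : Matrix (Fin n) (Fin m) ℝ)
    (Q : Matrix (Fin n) (Fin n) ℝ) (R : Matrix (Fin m) (Fin m) ℝ)
    (Z : Matrix (Fin n) (Fin n) ℝ)
    (X : Matrix (Fin n ⊕ Fin m) (Fin n ⊕ Fin m) ℝ) : EReal :=
  ⨅ (S : Matrix (Fin n ⊕ Fin m) (Fin n ⊕ Fin m) ℝ) (F : Matrix (Fin m) (Fin n) ℝ)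
    (_ : S.PosSemidef ∧ F ∈ stabGains μ w A B C D),
    ((lagrangian A B C D Q R Z X F S : ℝ) : EReal)

/-- The optimal value of the dual problem: the supremum of `d (X)` over symmetric `X`. -/
def dualValue {Ω : Type*} [MeasurableSpace Ω] {n m : ℕ} (μ : Measure Ω) (w : ℕ → Ω → ℝ)
    (A : Matrix (Fin n) (Fin n) ℝ) (B : Matrix (Fin n) (Fin m) ℝ)
    (C : Matrix (Fin n) (Fin n) ℝ) (D : Matrix (Fin n) (Fin m) ℝ)
    (Q : Matrix (Fin n) (Fin n) ℝ) (R : Matrix (Fin m) (Fin m) ℝ)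
    (Z : Matrix (Fin n) (Fin n) ℝ) : EReal :=
  ⨆ (X : Matrix (Fin n ⊕ Fin m) (Fin n ⊕ Fin m) ℝ) (_ : X.IsSymm),
    dualFun μ w A B C D Q R Z X

end

end SLQR

/-! Let q_P(x,u) be the one-step cost plus the P-value of the next state, the form of `qMat`. For
weak duality, stability forces every feasible S to be positive semidefinite, and at such S the
Lagrangian equals the cost.

Conversely, a strict supersolution P, with c|x|² + q_P(x,Fx) ≤ x'Px for some F and c > 0, certifies
that F is stabilizing and bounds the primal value by Tr(ZP) (`primalValue_le_trace`). A subsolution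
L, with x'Lx ≤ q_L(x,u) for all x, u, gives the multiplier X = `qMat` of L, whose dual value is at
least Tr(ZL) (`trace_le_lagrangian`).

Damped value iteration from a stabilizing gain produces a decreasing sequence of strict
supersolutions whose limit L is a subsolution (`exists_subsolution_tendsto`). Both bounds meet at
Tr(ZL). The limit itself need not be shown to yield a stabilizing gain, because the primal infimum
is only approached along the iterates. -/

namespace SLQR

/-! ### Quadratic forms, traces and limits of symmetric matrices -/

section QuadraticForms

variable {ι κ : Type*} [Fintype ι] [Fintype κ]

theorem posSemidef_iff_real {P : Matrix ι ι ℝ} :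
    P.PosSemidef ↔ P.IsSymm ∧ ∀ x : ι → ℝ, 0 ≤ x ⬝ᵥ P *ᵥ x := by
  rw [posSemidef_iff_dotProduct_mulVec]
  simp [IsHermitian, IsSymm, conjTranspose_eq_transpose_of_trivial]

theorem posSemidef_sub_iff_real {P K : Matrix ι ι ℝ} (hP : P.IsSymm) (hK : K.IsSymm) :
    (P - K).PosSemidef ↔ ∀ x : ι → ℝ, x ⬝ᵥ K *ᵥ x ≤ x ⬝ᵥ P *ᵥ x := by
  rw [posSemidef_iff_real]
  simp [hP.sub hK, sub_mulVec, dotProduct_sub]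

theorem PosSemidef.isSymm_real {P : Matrix ι ι ℝ} (hP : P.PosSemidef) : P.IsSymm :=
  (posSemidef_iff_real.1 hP).1

theorem dotProduct_self_nonneg_real (x : ι → ℝ) : 0 ≤ x ⬝ᵥ x :=
  Finset.sum_nonneg fun _ _ => mul_self_nonneg _

theorem dotProduct_congr_mulVec (G : Matrix κ ι ℝ) (P : Matrix κ κ ℝ) (x y : ι → ℝ) :
    x ⬝ᵥ (Gᵀ * P * G) *ᵥ y = (G *ᵥ x) ⬝ᵥ P *ᵥ (G *ᵥ y) := by
  rw [← mulVec_mulVec, ← mulVec_mulVec, dotProduct_mulVec, vecMul_transpose]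

theorem trace_mul_vecMulVec_real (P : Matrix ι ι ℝ) (x : ι → ℝ) :
    (P * vecMulVec x x).trace = x ⬝ᵥ P *ᵥ x := by
  rw [mul_vecMulVec, trace_vecMulVec, dotProduct_comm]

theorem dotProduct_mulVec_comm_of_isSymm {P : Matrix ι ι ℝ} (hP : P.IsSymm) (x y : ι → ℝ) :
    y ⬝ᵥ P *ᵥ x = x ⬝ᵥ P *ᵥ y := by
  rw [dotProduct_mulVec, dotProduct_comm, ← mulVec_transpose, hP.eq]

theorem PosSemidef.trace_mul_nonneg_real [DecidableEq ι] {S P : Matrix ι ι ℝ}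
    (hS : S.PosSemidef) (hP : P.PosSemidef) : 0 ≤ (S * P).trace := by
  open scoped MatrixOrder in
  obtain ⟨B, hB⟩ := CStarAlgebra.nonneg_iff_eq_star_mul_self.mp hS.nonneg
  rw [hB, Matrix.mul_assoc, trace_mul_comm]
  exact (hP.mul_mul_conjTranspose_same B).trace_nonneg

theorem PosSemidef.trace_mul_le_real [DecidableEq ι] {S P K : Matrix ι ι ℝ} (hS : S.PosSemidef)
    (h : (P - K).PosSemidef) : (S * K).trace ≤ (S * P).trace := by
  have := PosSemidef.trace_mul_nonneg_real hS h
  rw [Matrix.mul_sub, trace_sub] at this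
  linarith

theorem dotProduct_mulVec_le_sum_abs (W : Matrix ι ι ℝ) (x : ι → ℝ) :
    x ⬝ᵥ W *ᵥ x ≤ (∑ i, ∑ j, |W i j|) * (x ⬝ᵥ x) := by
  have h1 : ∀ i, x i * x i ≤ x ⬝ᵥ x := fun i =>
    Finset.single_le_sum (f := fun i => x i * x i) (fun i _ => mul_self_nonneg _)
      (Finset.mem_univ i)
  have h2 : ∀ i j, x i * (W i j * x j) ≤ |W i j| * (x ⬝ᵥ x) := by
    intro i j
    calc x i * (W i j * x j) = W i j * (x i * x j) := by ring
      _ ≤ |W i j * (x i * x j)| := le_abs_self _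
      _ = |W i j| * |x i * x j| := abs_mul _ _
      _ ≤ |W i j| * (x ⬝ᵥ x) := by
        refine mul_le_mul_of_nonneg_left ?_ (abs_nonneg _)
        rw [abs_le]
        constructor <;> nlinarith [h1 i, h1 j, sq_nonneg (x i + x j), sq_nonneg (x i - x j)]
  have h3 : x ⬝ᵥ W *ᵥ x = ∑ i, ∑ j, x i * (W i j * x j) := by
    simp only [dotProduct, mulVec, Finset.mul_sum]
  rw [h3, Finset.sum_mul]
  refine Finset.sum_le_sum fun i _ => ?_
  rw [Finset.sum_mul]
  exact Finset.sum_le_sum fun j _ => h2 i j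

theorem entry_eq_polarization [DecidableEq ι] {P : Matrix ι ι ℝ} (hP : P.IsSymm) (i j : ι) :
    P i j = ((Pi.single i 1 + Pi.single j 1) ⬝ᵥ P *ᵥ (Pi.single i 1 + Pi.single j 1)
      - (Pi.single i 1 - Pi.single j 1) ⬝ᵥ P *ᵥ (Pi.single i 1 - Pi.single j 1)) / 4 := by
  have h := hP.apply i j
  simp [mulVec_add, mulVec_sub, h]
  ring

/-- By polarization each entry is a fixed combination of two values of the form. -/
theorem tendsto_of_tendsto_forms {P : ℕ → Matrix ι ι ℝ} (hP : ∀ k, (P k).IsSymm)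
    {ℓ : (ι → ℝ) → ℝ} (h : ∀ x, Tendsto (fun k => x ⬝ᵥ P k *ᵥ x) atTop (𝓝 (ℓ x))) :
    ∃ L : Matrix ι ι ℝ, L.IsSymm ∧ Tendsto P atTop (𝓝 L) ∧ ∀ x, x ⬝ᵥ L *ᵥ x = ℓ x := by
  classical
  have hL : Tendsto P atTop (𝓝 (Matrix.of fun i j => (ℓ (Pi.single i 1 + Pi.single j 1)
      - ℓ (Pi.single i 1 - Pi.single j 1)) / 4)) := by
    refine tendsto_pi_nhds.2 fun i => tendsto_pi_nhds.2 fun j => ?_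
    simp_rw [fun k => entry_eq_polarization (hP k) i j]
    exact ((h _).sub (h _)).div_const 4
  refine ⟨_, ?_, hL, fun x => ?_⟩
  · refine tendsto_nhds_unique (((continuous_id.matrix_transpose).tendsto _).comp hL) ?_
    simpa [Function.comp_def, fun k => (hP k).eq] using hL
  · have hc : Continuous fun W : Matrix ι ι ℝ => x ⬝ᵥ W *ᵥ x := by fun_prop
    exact tendsto_nhds_unique ((hc.tendsto _).comp hL) (h x)

theorem tendsto_zero_of_tendsto_forms {P : ℕ → Matrix ι ι ℝ} (hP : ∀ k, (P k).IsSymm)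
    (h : ∀ x, Tendsto (fun k => x ⬝ᵥ P k *ᵥ x) atTop (𝓝 0)) : Tendsto P atTop (𝓝 0) := by
  classical
  refine tendsto_pi_nhds.2 fun i => tendsto_pi_nhds.2 fun j => ?_
  simp_rw [fun k => entry_eq_polarization (hP k) i j]
  convert ((h (Pi.single i 1 + Pi.single j 1)).sub
    (h (Pi.single i 1 - Pi.single j 1))).div_const 4 using 2
  simp

theorem exists_tendsto_of_antitone_forms {P : ℕ → Matrix ι ι ℝ} (hP : ∀ k, (P k).IsSymm)
    (hanti : ∀ x, Antitone fun k => x ⬝ᵥ P k *ᵥ x)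
    (hbdd : ∀ x, BddBelow (Set.range fun k => x ⬝ᵥ P k *ᵥ x)) :
    ∃ L : Matrix ι ι ℝ, L.IsSymm ∧ Tendsto P atTop (𝓝 L) := by
  obtain ⟨L, h1, h2, -⟩ := tendsto_of_tendsto_forms hP
    fun x => tendsto_atTop_ciInf (hanti x) (hbdd x)
  exact ⟨L, h1, h2⟩

theorem posSemidef_of_tendsto {P : ℕ → Matrix ι ι ℝ} {L : Matrix ι ι ℝ}
    (hP : ∀ k, (P k).PosSemidef) (hL : Tendsto P atTop (𝓝 L)) : L.PosSemidef := by
  refine posSemidef_iff_real.2 ⟨?_, fun x => ?_⟩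
  · refine tendsto_nhds_unique (((continuous_id.matrix_transpose).tendsto _).comp hL) ?_
    simpa [Function.comp_def, fun k => (PosSemidef.isSymm_real (hP k)).eq] using hL
  · have hc : Continuous fun W : Matrix ι ι ℝ => x ⬝ᵥ W *ᵥ x := by fun_prop
    exact ge_of_tendsto' ((hc.tendsto _).comp hL) fun k => (posSemidef_iff_real.1 (hP k)).2 x

end QuadraticForms

/-! ### Generalized Lyapunov operators and stability -/

section Lyapunov

variable {ι : Type*} [Fintype ι] [DecidableEq ι]

/-- The generalized Lyapunov operator `X ↦ G X G' + H X H'`. -/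
noncomputable def lyapOp (G H : Matrix ι ι ℝ) : Module.End ℝ (Matrix ι ι ℝ) where
  toFun X := G * X * Gᵀ + H * X * Hᵀ
  map_add' X Y := by simp only [Matrix.mul_add, Matrix.add_mul]; abel
  map_smul' c X := by simp

theorem lyapOp_apply (G H X : Matrix ι ι ℝ) : lyapOp G H X = G * X * Gᵀ + H * X * Hᵀ := rfl

theorem dotProduct_lyapOp_transpose (G H X : Matrix ι ι ℝ) (x : ι → ℝ) :
    x ⬝ᵥ lyapOp Gᵀ Hᵀ X *ᵥ x
      = (G *ᵥ x) ⬝ᵥ X *ᵥ (G *ᵥ x) + (H *ᵥ x) ⬝ᵥ X *ᵥ (H *ᵥ x) := by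
  simp only [lyapOp_apply, transpose_transpose, add_mulVec, dotProduct_add,
    dotProduct_congr_mulVec]

theorem lyapOp_isSymm (G H : Matrix ι ι ℝ) {X : Matrix ι ι ℝ} (hX : X.IsSymm) :
    (lyapOp G H X).IsSymm := by
  simp [IsSymm, lyapOp_apply, hX.eq, Matrix.mul_assoc]

theorem lyapOp_pow_isSymm (G H : Matrix ι ι ℝ) {X : Matrix ι ι ℝ} (hX : X.IsSymm) (k : ℕ) :
    ((lyapOp G H ^ k) X).IsSymm := by
  induction k with
  | zero => simpa
  | succ k ih => rw [pow_succ', Module.End.mul_apply]; exact lyapOp_isSymm G H ih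

theorem lyapOp_posSemidef (G H : Matrix ι ι ℝ) {X : Matrix ι ι ℝ} (hX : X.PosSemidef) :
    (lyapOp G H X).PosSemidef := by
  have h := (hX.mul_mul_conjTranspose_same G).add (hX.mul_mul_conjTranspose_same H)
  simpa [conjTranspose_eq_transpose_of_trivial, lyapOp_apply] using h

theorem lyapOp_pow_posSemidef (G H : Matrix ι ι ℝ) {X : Matrix ι ι ℝ} (hX : X.PosSemidef)
    (k : ℕ) : ((lyapOp G H ^ k) X).PosSemidef := by
  induction k with
  | zero => simpa
  | succ k ih => rw [pow_succ', Module.End.mul_apply]; exact lyapOp_posSemidef G H ih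

theorem trace_lyapOp_mul (G H X Y : Matrix ι ι ℝ) :
    (lyapOp G H X * Y).trace = (X * lyapOp Gᵀ Hᵀ Y).trace := by
  have key : ∀ K : Matrix ι ι ℝ, (K * X * Kᵀ * Y).trace = (X * (Kᵀ * Y * K)).trace := by
    intro K
    rw [Matrix.mul_assoc, Matrix.mul_assoc, trace_mul_comm, Matrix.mul_assoc]
  simp only [lyapOp_apply, transpose_transpose, Matrix.add_mul, Matrix.mul_add, trace_add, key]

theorem trace_lyapOp_pow_mul (G H X Y : Matrix ι ι ℝ) (k : ℕ) :
    ((lyapOp G H ^ k) X * Y).trace = (X * (lyapOp Gᵀ Hᵀ ^ k) Y).trace := by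
  induction k generalizing X with
  | zero => simp
  | succ k ih =>
    rw [pow_succ, Module.End.mul_apply, ih, trace_lyapOp_mul, pow_succ', Module.End.mul_apply]

/-- The matrix form of mean square stability of `[G; H]`. -/
def IsStablePair (G H : Matrix ι ι ℝ) : Prop :=
  ∀ z : ι → ℝ, Tendsto (fun k => z ⬝ᵥ (lyapOp Gᵀ Hᵀ ^ k) 1 *ᵥ z) atTop (𝓝 0)

theorem IsStablePair.exists_lyapunov {G H : Matrix ι ι ℝ} (h : IsStablePair G H)
    (M : Matrix ι ι ℝ) :
    ∃ P : Matrix ι ι ℝ, P.PosSemidef ∧ ∀ x : ι → ℝ,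
      x ⬝ᵥ x + x ⬝ᵥ M *ᵥ x + x ⬝ᵥ lyapOp Gᵀ Hᵀ P *ᵥ x ≤ x ⬝ᵥ P *ᵥ x := by
  set T := lyapOp Gᵀ Hᵀ
  have hpsd : ∀ k, ((T ^ k) 1).PosSemidef := fun k => lyapOp_pow_posSemidef _ _ PosSemidef.one k
  have h0 : Tendsto (fun k => (T ^ k) (1 : Matrix ι ι ℝ)) atTop (𝓝 0) :=
    tendsto_zero_of_tendsto_forms (fun k => PosSemidef.isSymm_real (hpsd k)) h
  have hc : Continuous fun W : Matrix ι ι ℝ => ∑ i, ∑ j, |W i j| := by fun_prop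
  have h1 := (hc.tendsto 0).comp h0
  simp only [Matrix.zero_apply, abs_zero, Finset.sum_const_zero, Function.comp_def] at h1
  obtain ⟨N, hN⟩ := (h1.eventually (gt_mem_nhds (show (0 : ℝ) < 1 / 2 by norm_num))).exists
  set a : ℝ := ∑ i, ∑ j, |M i j|
  have ha : 0 ≤ a := Finset.sum_nonneg fun i _ => Finset.sum_nonneg fun j _ => abs_nonneg _
  -- With T^N 1 ≤ 1/2, the truncated sum Σ has Σ - TΣ = 1 - T^N 1 ≥ 1/2. Scaling by 2(a + 1) gives a
  -- + 1, which dominates 1 + M.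
  refine ⟨(2 * (a + 1)) • ∑ k ∈ Finset.range N, (T ^ k) 1,
    (posSemidef_sum _ fun k _ => hpsd k).smul (by positivity), fun x => ?_⟩
  have hT : T (∑ k ∈ Finset.range N, (T ^ k) 1)
      = ∑ k ∈ Finset.range N, (T ^ k) 1 + (T ^ N) 1 - 1 := by
    rw [map_sum, ← Finset.sum_range_succ, Finset.sum_range_succ']
    simp [pow_succ']
  have hx : 0 ≤ x ⬝ᵥ x := dotProduct_self_nonneg_real x
  have e1 := dotProduct_mulVec_le_sum_abs M x
  have e2 := (dotProduct_mulVec_le_sum_abs ((T ^ N) 1) x).trans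
    (mul_le_mul_of_nonneg_right hN.le hx)
  rw [map_smul, hT]
  simp only [smul_mulVec, add_mulVec, sub_mulVec, dotProduct_add, dotProduct_sub, dotProduct_smul,
    one_mulVec, smul_eq_mul]
  nlinarith

/-- Applying T^k to c·1 ≤ P - TP gives a telescoping bound, so the mean squares are summable and
hence tend to zero. -/
theorem isStablePair_of_lyapunov {G H P : Matrix ι ι ℝ} (hP : P.PosSemidef) {c : ℝ} (hc : 0 < c)
    (h : ∀ x : ι → ℝ, c * (x ⬝ᵥ x) + x ⬝ᵥ lyapOp Gᵀ Hᵀ P *ᵥ x ≤ x ⬝ᵥ P *ᵥ x) :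
    IsStablePair G H := by
  intro z
  set T := lyapOp Gᵀ Hᵀ
  have h1 : (P - (c • 1 + T P)).PosSemidef := by
    refine (posSemidef_sub_iff_real (PosSemidef.isSymm_real hP) ?_).2 fun x => ?_
    · exact (isSymm_one.smul c).add (lyapOp_isSymm _ _ (PosSemidef.isSymm_real hP))
    · simpa [add_mulVec, smul_mulVec] using h x
  have h2 : ∀ k, c * (z ⬝ᵥ (T ^ k) 1 *ᵥ z)
      ≤ z ⬝ᵥ (T ^ k) P *ᵥ z - z ⬝ᵥ (T ^ (k + 1)) P *ᵥ z := by
    intro k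
    have := (posSemidef_iff_real.1 (lyapOp_pow_posSemidef Gᵀ Hᵀ h1 k)).2 z
    change 0 ≤ z ⬝ᵥ (T ^ k) _ *ᵥ z at this
    rw [map_sub, map_add, map_smul, ← Module.End.mul_apply, ← pow_succ] at this
    simp only [sub_mulVec, add_mulVec, smul_mulVec, dotProduct_sub, dotProduct_add,
      dotProduct_smul, smul_eq_mul] at this
    linarith
  have h3 : ∀ N, ∑ k ∈ Finset.range N, c * (z ⬝ᵥ (T ^ k) 1 *ᵥ z) ≤ z ⬝ᵥ P *ᵥ z := by
    intro N
    refine (Finset.sum_le_sum fun k _ => h2 k).trans ?_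
    rw [Finset.sum_range_sub' fun k => z ⬝ᵥ (T ^ k) P *ᵥ z]
    have := (posSemidef_iff_real.1 (lyapOp_pow_posSemidef Gᵀ Hᵀ hP N)).2 z
    simpa using this
  have h4 : Summable fun k => c * (z ⬝ᵥ (T ^ k) 1 *ᵥ z) :=
    summable_of_sum_range_le (fun k => mul_nonneg hc.le
      ((posSemidef_iff_real.1 (lyapOp_pow_posSemidef Gᵀ Hᵀ PosSemidef.one k)).2 z)) h3
  simpa [hc.ne'] using h4.tendsto_atTop_zero.const_mul c⁻¹

/-- Stability concerns the adjoint operator. Trace duality rewrites the form as Tr(Y T^k(zz')), and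
zz' ≤ s·1 forces T^k(zz') → 0. -/
theorem IsStablePair.tendsto_lyapOp_pow {G H : Matrix ι ι ℝ} (h : IsStablePair G H)
    (Y : Matrix ι ι ℝ) (z : ι → ℝ) :
    Tendsto (fun k => z ⬝ᵥ (lyapOp G H ^ k) Y *ᵥ z) atTop (𝓝 0) := by
  set W := vecMulVec z z
  have hW : W.PosSemidef := by simpa using posSemidef_vecMulVec_self_star z
  set s : ℝ := ∑ i, ∑ j, |W i j|
  have hle : (s • (1 : Matrix ι ι ℝ) - W).PosSemidef := by
    refine (posSemidef_sub_iff_real (isSymm_one.smul s) (PosSemidef.isSymm_real hW)).2 fun x => ?_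
    simpa [smul_mulVec] using dotProduct_mulVec_le_sum_abs W x
  have h0 : Tendsto (fun k => (lyapOp Gᵀ Hᵀ ^ k) W) atTop (𝓝 0) := by
    refine tendsto_zero_of_tendsto_forms
      (fun k => lyapOp_pow_isSymm _ _ (PosSemidef.isSymm_real hW) k) fun x => ?_
    refine squeeze_zero (fun k => (posSemidef_iff_real.1 (lyapOp_pow_posSemidef _ _ hW k)).2 x)
      (fun k => ?_) (by simpa using (h x).const_mul s)
    have := (posSemidef_iff_real.1 (lyapOp_pow_posSemidef Gᵀ Hᵀ hle k)).2 x
    simpa [sub_mulVec, smul_mulVec] using this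
  have hc : Continuous fun W : Matrix ι ι ℝ => (Y * W).trace := by fun_prop
  have h1 := (hc.tendsto 0).comp h0
  simp only [Matrix.mul_zero, trace_zero, Function.comp_def] at h1
  refine h1.congr fun k => ?_
  rw [← trace_lyapOp_pow_mul, trace_mul_vecMulVec_real]

/-- Iterating the equation makes Y - U^k Y a sum of positive semidefinite terms, while U^k Y → 0. -/
theorem IsStablePair.posSemidef_of_lyapOp_add {G H Y Z : Matrix ι ι ℝ} (h : IsStablePair G H)
    (hY : Y.IsSymm) (hZ : Z.PosSemidef) (hYZ : lyapOp G H Y + Z = Y) : Y.PosSemidef := by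
  have h1 : ∀ k, (Y - (lyapOp G H ^ k) Y).PosSemidef := by
    intro k
    induction k with
    | zero => simpa using PosSemidef.zero
    | succ k ih =>
      have h2 := hZ.add (lyapOp_posSemidef G H ih)
      rw [map_sub, ← Module.End.mul_apply, ← pow_succ', eq_sub_of_add_eq hYZ] at h2
      convert h2 using 1
      abel
  refine posSemidef_iff_real.2 ⟨hY, fun z => ?_⟩
  refine le_of_tendsto' (h.tendsto_lyapOp_pow Y z) fun k => ?_
  exact (posSemidef_sub_iff_real hY (lyapOp_pow_isSymm _ _ hY k)).1 (h1 k) z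

theorem IsStablePair.exists_gramian {G H Z : Matrix ι ι ℝ} (h : IsStablePair G H)
    (hZ : Z.PosSemidef) : ∃ Y : Matrix ι ι ℝ, Y.PosSemidef ∧ lyapOp G H Y + Z = Y := by
  set U := lyapOp G H
  have hpsd : ∀ k, ((U ^ k) Z).PosSemidef := fun k => lyapOp_pow_posSemidef _ _ hZ k
  set S : ℕ → Matrix ι ι ℝ := fun N => ∑ k ∈ Finset.range N, (U ^ k) Z
  have hS : ∀ N, (S N).PosSemidef := fun N => posSemidef_sum _ fun k _ => hpsd k
  have hrec : ∀ N, U (S N) + Z = S (N + 1) := by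
    intro N
    simp only [S]
    rw [map_sum, Finset.sum_range_succ']
    simp [pow_succ']
  -- The partial sums increase, so their negatives are fed to the antitone convergence lemma.
  have hneg : ∃ L : Matrix ι ι ℝ, L.IsSymm ∧ Tendsto (fun N => -S N) atTop (𝓝 L) := by
    refine exists_tendsto_of_antitone_forms (fun N => (PosSemidef.isSymm_real (hS N)).neg)
      (fun x => antitone_nat_of_succ_le fun N => ?_) fun x => ?_
    · have := (posSemidef_iff_real.1 (hpsd N)).2 x
      simp only [S, Finset.sum_range_succ, neg_mulVec, dotProduct_neg, add_mulVec, dotProduct_add]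
      linarith
    -- A Lyapunov matrix chosen for this x, with P - TP ≥ xx', telescopes to the bound Tr(ZP),
    -- uniform in N.
    · obtain ⟨P, hP, hPx⟩ := h.exists_lyapunov (vecMulVec x x)
      have hW : (vecMulVec x x).PosSemidef := by simpa using posSemidef_vecMulVec_self_star x
      have hd : (P - lyapOp Gᵀ Hᵀ P - vecMulVec x x).PosSemidef := by
        refine (posSemidef_sub_iff_real ((PosSemidef.isSymm_real hP).sub
          (lyapOp_isSymm _ _ (PosSemidef.isSymm_real hP))) (PosSemidef.isSymm_real hW)).2
            fun y => ?_
        have h1 := hPx y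
        have h2 := dotProduct_self_nonneg_real y
        simp only [sub_mulVec, dotProduct_sub]
        linarith
      refine ⟨-(Z * P).trace, ?_⟩
      rintro _ ⟨N, rfl⟩
      have h1 : ∀ k, ((U ^ k) Z * vecMulVec x x).trace
          ≤ ((U ^ k) Z * P).trace - ((U ^ (k + 1)) Z * P).trace := by
        intro k
        have := PosSemidef.trace_mul_le_real (hpsd k) hd
        rwa [Matrix.mul_sub, trace_sub, ← trace_lyapOp_mul, ← Module.End.mul_apply (lyapOp G H),
          ← pow_succ'] at this
      have h2 : x ⬝ᵥ S N *ᵥ x ≤ (Z * P).trace := by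
        rw [← trace_mul_vecMulVec_real, Finset.sum_mul, trace_sum]
        refine (Finset.sum_le_sum fun k _ => h1 k).trans ?_
        rw [Finset.sum_range_sub' fun k => ((U ^ k) Z * P).trace]
        have := PosSemidef.trace_mul_nonneg_real (hpsd N) hP
        simpa using this
      simpa [neg_mulVec] using h2
  obtain ⟨L, -, hL⟩ := hneg
  have hL' : Tendsto S atTop (𝓝 (-L)) := by simpa using hL.neg
  refine ⟨-L, posSemidef_of_tendsto hS hL', ?_⟩
  have hc : Continuous fun W : Matrix ι ι ℝ => G * W * Gᵀ + H * W * Hᵀ + Z := by fun_prop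
  refine tendsto_nhds_unique ((hc.tendsto _).comp hL') ?_
  refine ((tendsto_add_atTop_iff_nat 1).2 hL').congr fun N => ?_
  exact (hrec N).symm

end Lyapunov

/-! ### Second moments of the stochastic trajectory -/

section MeanSquare

/-- The state at time k depends only on the noises with index below k, which makes it independent of
`w k`. -/
theorem traj_eq_measurable_comp {Ω : Type*} {n : ℕ} (w : ℕ → Ω → ℝ) (G H : Matrix (Fin n) (Fin n) ℝ)
    (z : Fin n → ℝ) (k : ℕ) :
    ∃ f : (Finset.range k → ℝ) → Fin n → ℝ, Measurable f ∧
      ∀ ω, traj w G H z k ω = f fun i => w i ω := by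
  induction k with
  | zero => exact ⟨fun _ => z, measurable_const, fun _ => rfl⟩
  | succ k ih =>
    obtain ⟨f, hf, hfx⟩ := ih
    have hsub : ∀ i : Finset.range k, (i : ℕ) ∈ Finset.range (k + 1) := fun i =>
      Finset.range_subset_range.2 k.le_succ i.2
    refine ⟨fun v => G *ᵥ f (fun i => v ⟨i, hsub i⟩)
      + v ⟨k, Finset.self_mem_range_succ k⟩ • (H *ᵥ f fun i => v ⟨i, hsub i⟩), ?_, fun ω => ?_⟩
    · have h1 : Measurable fun v : Finset.range (k + 1) → ℝ => f fun i => v ⟨i, hsub i⟩ :=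
        hf.comp (measurable_pi_lambda _ fun i => measurable_pi_apply _)
      have h2 : ∀ K : Matrix (Fin n) (Fin n) ℝ, Measurable fun x : Fin n → ℝ => K *ᵥ x :=
        fun K => (by fun_prop : Continuous fun x : Fin n → ℝ => K *ᵥ x).measurable
      exact ((h2 G).comp h1).add ((measurable_pi_apply _).smul ((h2 H).comp h1))
    · simp [traj, hfx ω]

variable {Ω : Type*} [MeasurableSpace Ω] {μ : Measure Ω} {w : ℕ → Ω → ℝ} {n : ℕ}

theorem IsNoise.indepFun_traj (hw : IsNoise μ w) (G H : Matrix (Fin n) (Fin n) ℝ)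
    (z : Fin n → ℝ) (k : ℕ) : IndepFun (w k) (traj w G H z k) μ := by
  obtain ⟨f, hf, hfx⟩ := traj_eq_measurable_comp w G H z k
  have h := hw.indep.indepFun_finset {k} (Finset.range k) (by simp) hw.measurable
  have h' := h.comp (measurable_pi_apply (⟨k, by simp⟩ : ({k} : Finset ℕ))) hf
  rwa [show traj w G H z k = f ∘ fun ω (i : Finset.range k) => w i ω from funext hfx]

/-- Expanding one step, independence removes the term linear in the noise (mean 0) and keeps the
quadratic one (variance 1). What remains is the form of the adjoint Lyapunov operator at W, hence
the induction over all W. -/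
theorem IsNoise.integral_form_traj [IsProbabilityMeasure μ] (hw : IsNoise μ w)
    (G H : Matrix (Fin n) (Fin n) ℝ) (z : Fin n → ℝ) (k : ℕ) (W : Matrix (Fin n) (Fin n) ℝ) :
    Integrable (fun ω => traj w G H z k ω ⬝ᵥ W *ᵥ traj w G H z k ω) μ ∧
      ∫ ω, traj w G H z k ω ⬝ᵥ W *ᵥ traj w G H z k ω ∂μ
        = z ⬝ᵥ (lyapOp Gᵀ Hᵀ ^ k) W *ᵥ z := by
  induction k generalizing W with
  | zero => simp [traj]
  | succ k ih =>
    set x := traj w G H z k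
    have hmeas : ∀ V : Matrix (Fin n) (Fin n) ℝ, Measurable fun y : Fin n → ℝ => y ⬝ᵥ V *ᵥ y :=
      fun V => (by fun_prop : Continuous fun y : Fin n → ℝ => y ⬝ᵥ V *ᵥ y).measurable
    have hind := hw.indepFun_traj G H z k
    have hw1 : Integrable (w k) μ := (hw.memLp k).integrable one_le_two
    have hw2 : Integrable (fun ω => w k ω ^ 2) μ := (hw.memLp k).integrable_sq
    have hmean2 : ∫ ω, w k ω ^ 2 ∂μ = 1 := by simpa [sq] using hw.cov k k
    have hlin : ∀ V : Matrix (Fin n) (Fin n) ℝ,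
        Integrable (fun ω => w k ω * (x ω ⬝ᵥ V *ᵥ x ω)) μ ∧
          ∫ ω, w k ω * (x ω ⬝ᵥ V *ᵥ x ω) ∂μ = 0 := by
      intro V
      have hi : IndepFun (w k) (fun ω => x ω ⬝ᵥ V *ᵥ x ω) μ :=
        hind.comp measurable_id (hmeas V)
      refine ⟨hi.integrable_mul hw1 (ih V).1, ?_⟩
      refine (hi.integral_mul_eq_mul_integral hw1.aestronglyMeasurable
        (ih V).1.aestronglyMeasurable).trans ?_
      rw [hw.mean k, zero_mul]
    have hsq : ∀ V : Matrix (Fin n) (Fin n) ℝ,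
        Integrable (fun ω => w k ω ^ 2 * (x ω ⬝ᵥ V *ᵥ x ω)) μ ∧
          ∫ ω, w k ω ^ 2 * (x ω ⬝ᵥ V *ᵥ x ω) ∂μ = ∫ ω, x ω ⬝ᵥ V *ᵥ x ω ∂μ := by
      intro V
      have hi : IndepFun (fun ω => w k ω ^ 2) (fun ω => x ω ⬝ᵥ V *ᵥ x ω) μ :=
        hind.comp (measurable_id.pow_const 2) (hmeas V)
      refine ⟨hi.integrable_mul hw2 (ih V).1, ?_⟩
      refine (hi.integral_mul_eq_mul_integral hw2.aestronglyMeasurable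
        (ih V).1.aestronglyMeasurable).trans ?_
      rw [hmean2, one_mul]
    have hexp : ∀ ω, traj w G H z (k + 1) ω ⬝ᵥ W *ᵥ traj w G H z (k + 1) ω
        = x ω ⬝ᵥ (Gᵀ * W * G) *ᵥ x ω
          + w k ω * (x ω ⬝ᵥ (Gᵀ * W * H + Hᵀ * W * G) *ᵥ x ω)
          + w k ω ^ 2 * (x ω ⬝ᵥ (Hᵀ * W * H) *ᵥ x ω) := by
      intro ω
      have e : ∀ K L : Matrix (Fin n) (Fin n) ℝ,
          x ω ⬝ᵥ (Kᵀ * W * L) *ᵥ x ω = (K *ᵥ x ω) ⬝ᵥ W *ᵥ (L *ᵥ x ω) := by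
        intro K L
        rw [← mulVec_mulVec, ← mulVec_mulVec, dotProduct_mulVec, vecMul_transpose]
      change (G *ᵥ x ω + w k ω • (H *ᵥ x ω)) ⬝ᵥ W *ᵥ (G *ᵥ x ω + w k ω • (H *ᵥ x ω)) = _
      rw [add_mulVec, dotProduct_add, e, e, e, e]
      simp only [mulVec_add, mulVec_smul, dotProduct_add, add_dotProduct, smul_dotProduct,
        dotProduct_smul, smul_eq_mul]
      ring
    simp_rw [hexp]
    have i1 := (ih (Gᵀ * W * G)).1
    have i2 := hlin (Gᵀ * W * H + Hᵀ * W * G)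
    have i3 := hsq (Hᵀ * W * H)
    have i12 : Integrable (fun ω => x ω ⬝ᵥ (Gᵀ * W * G) *ᵥ x ω
        + w k ω * (x ω ⬝ᵥ (Gᵀ * W * H + Hᵀ * W * G) *ᵥ x ω)) μ := i1.add i2.1
    refine ⟨i12.add i3.1, ?_⟩
    rw [integral_add i12 i3.1, integral_add i1 i2.1, i2.2, i3.2, add_zero,
      ← integral_add i1 (ih _).1, pow_succ, Module.End.mul_apply, ← (ih _).2]
    simp only [lyapOp_apply, transpose_transpose, add_mulVec, dotProduct_add]

theorem IsNoise.isASMS_iff [IsProbabilityMeasure μ] (hw : IsNoise μ w)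
    (G H : Matrix (Fin n) (Fin n) ℝ) : IsASMS μ w G H ↔ IsStablePair G H := by
  refine forall_congr' fun z => ?_
  have : meanSq μ w G H z = fun k => z ⬝ᵥ (lyapOp Gᵀ Hᵀ ^ k) 1 *ᵥ z := by
    funext k
    rw [← (hw.integral_form_traj G H z k 1).2]
    simp [meanSq]
  rw [this]

end MeanSquare

theorem isSymm_congr {ι κ : Type*} [Fintype ι] [Fintype κ] {X : Matrix ι ι ℝ} (hX : X.IsSymm)
    (V : Matrix ι κ ℝ) : (Vᵀ * X * V).IsSymm := by
  simp [IsSymm, hX.eq, Matrix.mul_assoc]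

/-! ### Riccati inequalities and damped value iteration -/

section Bellman

variable {n m : ℕ} (A : Matrix (Fin n) (Fin n) ℝ) (B : Matrix (Fin n) (Fin m) ℝ)
  (C : Matrix (Fin n) (Fin n) ℝ) (D : Matrix (Fin n) (Fin m) ℝ)
  (Q : Matrix (Fin n) (Fin n) ℝ) (R : Matrix (Fin m) (Fin m) ℝ)

/-- The matrix of the quadratic form
`(x, u) ↦ x' Q x + u' R u + (A x + B u)' P (A x + B u) + (C x + D u)' P (C x + D u)`. -/
noncomputable def qMat (P : Matrix (Fin n) (Fin n) ℝ) :
    Matrix (Fin n ⊕ Fin m) (Fin n ⊕ Fin m) ℝ :=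
  costMat Q R + ((fromCols A B)ᵀ * P * fromCols A B + (fromCols C D)ᵀ * P * fromCols C D)

variable {Q R} in
theorem costMat_isSymm (hQ : Q.IsSymm) (hR : R.IsSymm) : (costMat Q R).IsSymm :=
  hQ.fromBlocks rfl hR

variable {Q R} in
theorem qMat_isSymm (hQ : Q.IsSymm) (hR : R.IsSymm) {P : Matrix (Fin n) (Fin n) ℝ}
    (hP : P.IsSymm) : (qMat A B C D Q R P).IsSymm := by
  exact (costMat_isSymm hQ hR).add ((isSymm_congr hP _).add (isSymm_congr hP _))

theorem dotProduct_qMat (P : Matrix (Fin n) (Fin n) ℝ) (x : Fin n → ℝ) (u : Fin m → ℝ) :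
    Sum.elim x u ⬝ᵥ qMat A B C D Q R P *ᵥ Sum.elim x u
      = x ⬝ᵥ Q *ᵥ x + u ⬝ᵥ R *ᵥ u + ((A *ᵥ x + B *ᵥ u) ⬝ᵥ P *ᵥ (A *ᵥ x + B *ᵥ u)
        + (C *ᵥ x + D *ᵥ u) ⬝ᵥ P *ᵥ (C *ᵥ x + D *ᵥ u)) := by
  rw [qMat, add_mulVec, add_mulVec, dotProduct_add, dotProduct_add, dotProduct_congr_mulVec,
    dotProduct_congr_mulVec]
  simp [costMat, fromBlocks_mulVec, fromCols_mulVec]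

/-- The matrix `[I; F]`. -/
noncomputable def feedbackMat (F : Matrix (Fin m) (Fin n) ℝ) : Matrix (Fin n ⊕ Fin m) (Fin n) ℝ :=
  fromRows 1 F

theorem feedbackMat_mulVec (F : Matrix (Fin m) (Fin n) ℝ) (x : Fin n → ℝ) :
    feedbackMat F *ᵥ x = Sum.elim x (F *ᵥ x) := by
  simp [feedbackMat, fromRows_mulVec]

theorem fromCols_mul_feedbackMat (F : Matrix (Fin m) (Fin n) ℝ) :
    fromCols A B * feedbackMat F = A + B * F := by
  simp [feedbackMat, fromCols_mul_fromRows]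

theorem augMat_eq_mul (F : Matrix (Fin m) (Fin n) ℝ) :
    augMat A B F = feedbackMat F * fromCols A B := by
  rw [augMat, feedbackMat, fromRows_mul_fromCols, Matrix.one_mul, Matrix.one_mul]

theorem congr_qMat (P : Matrix (Fin n) (Fin n) ℝ) (F : Matrix (Fin m) (Fin n) ℝ) :
    (feedbackMat F)ᵀ * qMat A B C D Q R P * feedbackMat F
      = (feedbackMat F)ᵀ * costMat Q R * feedbackMat F
        + lyapOp (A + B * F)ᵀ (C + D * F)ᵀ P := by
  rw [lyapOp_apply, ← fromCols_mul_feedbackMat A B F, ← fromCols_mul_feedbackMat C D F]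
  simp only [qMat, Matrix.mul_add, Matrix.add_mul, transpose_mul, transpose_transpose,
    Matrix.mul_assoc]

/-- A symmetric form that is positive definite in its second argument is minimized over that
argument by a linear feedback. -/
theorem exists_feedback_argmin {X : Matrix (Fin n ⊕ Fin m) (Fin n ⊕ Fin m) ℝ} (hX : X.IsSymm)
    (hpos : ∀ d : Fin m → ℝ, d ≠ 0 → 0 < Sum.elim 0 d ⬝ᵥ X *ᵥ Sum.elim (0 : Fin n → ℝ) d) :
    ∃ F : Matrix (Fin m) (Fin n) ℝ, ∀ x u,
      Sum.elim x (F *ᵥ x) ⬝ᵥ X *ᵥ Sum.elim x (F *ᵥ x) ≤ Sum.elim x u ⬝ᵥ X *ᵥ Sum.elim x u := by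
  set X₂ := X.toBlocks₂₂
  have hblock : ∀ (x : Fin n → ℝ) (v d : Fin m → ℝ),
      Sum.elim 0 d ⬝ᵥ X *ᵥ Sum.elim x v = d ⬝ᵥ (X.toBlocks₂₁ *ᵥ x + X₂ *ᵥ v) := by
    intro x v d
    conv_lhs => rw [← fromBlocks_toBlocks X]
    simp [fromBlocks_mulVec, X₂]
  have hX₂ : X₂.PosDef := by
    refine PosDef.of_dotProduct_mulVec_pos ?_ fun {d} hd => ?_
    · ext i j
      simpa [X₂, toBlocks₂₂] using hX.apply (Sum.inr i) (Sum.inr j)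
    · simpa [hblock] using hpos d hd
  have hdet : IsUnit X₂.det := (isUnit_iff_isUnit_det _).1 hX₂.isUnit
  refine ⟨-(X₂⁻¹ * X.toBlocks₂₁), fun x u => ?_⟩
  set v := -(X₂⁻¹ * X.toBlocks₂₁) *ᵥ x
  -- First-order optimality at v: it kills the cross term, leaving only the positive form in u - v.
  have hv : X.toBlocks₂₁ *ᵥ x + X₂ *ᵥ v = 0 := by
    simp [v, neg_mulVec, mulVec_neg, mulVec_mulVec, mul_nonsing_inv_cancel_left _ _ hdet]
  have hu : Sum.elim x u = Sum.elim x v + Sum.elim (0 : Fin n → ℝ) (u - v) := by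
    ext (i | i) <;> simp
  have h1 : Sum.elim 0 (u - v) ⬝ᵥ X *ᵥ Sum.elim x v = 0 := by rw [hblock, hv, dotProduct_zero]
  have h2 := dotProduct_mulVec_comm_of_isSymm hX (Sum.elim x v) (Sum.elim 0 (u - v))
  have h3 : 0 ≤ Sum.elim 0 (u - v) ⬝ᵥ X *ᵥ Sum.elim (0 : Fin n → ℝ) (u - v) := by
    by_cases h : u - v = 0
    · have : Sum.elim (0 : Fin n → ℝ) (0 : Fin m → ℝ) = 0 := by ext (i | i) <;> rfl
      simp [h, this]
    · exact (hpos _ h).le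
  rw [hu, mulVec_add, dotProduct_add, add_dotProduct, add_dotProduct]
  linarith

/-- `P` is a strict supersolution of the Riccati equation under some feedback. -/
def IsStrictSupersolution (P : Matrix (Fin n) (Fin n) ℝ) : Prop :=
  P.PosSemidef ∧ ∃ F : Matrix (Fin m) (Fin n) ℝ, ∃ c : ℝ, 0 < c ∧ ∀ x : Fin n → ℝ,
    c * (x ⬝ᵥ x) + Sum.elim x (F *ᵥ x) ⬝ᵥ qMat A B C D Q R P *ᵥ Sum.elim x (F *ᵥ x)
      ≤ x ⬝ᵥ P *ᵥ x

variable {A B C D Q R}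

theorem IsStrictSupersolution.exists_improvement (hQ : Q.PosSemidef) (hR : R.PosDef)
    {P : Matrix (Fin n) (Fin n) ℝ} (h : IsStrictSupersolution A B C D Q R P) :
    ∃ P', IsStrictSupersolution A B C D Q R P' ∧ (∀ x, x ⬝ᵥ P' *ᵥ x ≤ x ⬝ᵥ P *ᵥ x) ∧
      ∀ x u, x ⬝ᵥ P' *ᵥ x
        ≤ (x ⬝ᵥ P *ᵥ x + Sum.elim x u ⬝ᵥ qMat A B C D Q R P *ᵥ Sum.elim x u) / 2 := by
  obtain ⟨hP, F₀, c, hc, hF₀⟩ := h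
  have hPx := (posSemidef_iff_real.1 hP).2
  have hQx := (posSemidef_iff_real.1 hQ).2
  have hX := qMat_isSymm A B C D (PosSemidef.isSymm_real hQ)
    (PosSemidef.isSymm_real hR.posSemidef) (PosSemidef.isSymm_real hP)
  obtain ⟨F, hF⟩ := exists_feedback_argmin hX fun d hd => by
    have h1 : 0 < d ⬝ᵥ R *ᵥ d := by simpa using hR.dotProduct_mulVec_pos hd
    have h2 := hPx (B *ᵥ d)
    have h3 := hPx (D *ᵥ d)
    rw [dotProduct_qMat]
    simp only [mulVec_zero, zero_add, dotProduct_zero]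
    linarith
  set K := (feedbackMat F)ᵀ * qMat A B C D Q R P * feedbackMat F
  have hKx : ∀ x, x ⬝ᵥ K *ᵥ x
      = Sum.elim x (F *ᵥ x) ⬝ᵥ qMat A B C D Q R P *ᵥ Sum.elim x (F *ᵥ x) := by
    intro x
    rw [dotProduct_congr_mulVec, feedbackMat_mulVec]
  have hKP : ∀ x, c * (x ⬝ᵥ x) + x ⬝ᵥ K *ᵥ x ≤ x ⬝ᵥ P *ᵥ x := by
    intro x
    rw [hKx]
    linarith [hF x (F₀ *ᵥ x), hF₀ x]
  have hKP' : ∀ x, x ⬝ᵥ K *ᵥ x ≤ x ⬝ᵥ P *ᵥ x := fun x => by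
    linarith [hKP x, mul_nonneg hc.le (dotProduct_self_nonneg_real x)]
  have hK0 : ∀ x, 0 ≤ x ⬝ᵥ K *ᵥ x := by
    intro x
    rw [hKx, dotProduct_qMat]
    have h1 := (posSemidef_iff_real.1 hR.posSemidef).2 (F *ᵥ x)
    linarith [hQx x, hPx (A *ᵥ x + B *ᵥ F *ᵥ x), hPx (C *ᵥ x + D *ᵥ F *ᵥ x)]
  have hKs : K.IsSymm := isSymm_congr hX _
  have hform : ∀ x, x ⬝ᵥ ((1 / 2 : ℝ) • (P + K)) *ᵥ x
      = (x ⬝ᵥ P *ᵥ x + x ⬝ᵥ K *ᵥ x) / 2 := by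
    intro x
    simp only [smul_mulVec, add_mulVec, dotProduct_smul, dotProduct_add, smul_eq_mul]
    ring
  -- The full step K could lose strictness. For the average P', q_{P'}(x,Fx) ≤ q_P(x,Fx) = K, and K
  -- lies below P' by at least c/2, so half the margin survives.
  refine ⟨(1 / 2 : ℝ) • (P + K), ⟨?_, F, c / 2, by positivity, fun x => ?_⟩, fun x => ?_,
    fun x u => ?_⟩
  · refine posSemidef_iff_real.2 ⟨((PosSemidef.isSymm_real hP).add hKs).smul _, fun x => ?_⟩
    rw [hform]
    linarith [hPx x, hK0 x]
  · have h1 := hKx x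
    rw [dotProduct_qMat] at h1 ⊢
    rw [hform, hform, hform]
    linarith [hKP x, hKP' (A *ᵥ x + B *ᵥ F *ᵥ x), hKP' (C *ᵥ x + D *ᵥ F *ᵥ x)]
  · rw [hform]
    linarith [hKP' x]
  · rw [hform, hKx]
    linarith [hF x u]

/-- A subsolution of the Riccati equation which is a limit of strict supersolutions. -/
theorem exists_subsolution_tendsto (hQ : Q.PosSemidef) (hR : R.PosDef)
    {P₀ : Matrix (Fin n) (Fin n) ℝ} (h₀ : IsStrictSupersolution A B C D Q R P₀) :
    ∃ (P : ℕ → Matrix (Fin n) (Fin n) ℝ) (L : Matrix (Fin n) (Fin n) ℝ),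
      (∀ k, IsStrictSupersolution A B C D Q R (P k)) ∧ Tendsto P atTop (𝓝 L) ∧ L.IsSymm ∧
        ∀ x u, x ⬝ᵥ L *ᵥ x ≤ Sum.elim x u ⬝ᵥ qMat A B C D Q R L *ᵥ Sum.elim x u := by
  choose! f hf1 hf2 hf3 using
    fun P (h : IsStrictSupersolution A B C D Q R P) => h.exists_improvement hQ hR
  have hV : ∀ k, IsStrictSupersolution A B C D Q R (f^[k] P₀) := by
    intro k
    induction k with
    | zero => exact h₀
    | succ k ih => rw [Function.iterate_succ_apply']; exact hf1 _ ih
  obtain ⟨L, hLs, hL⟩ := exists_tendsto_of_antitone_forms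
    (P := fun k => f^[k] P₀) (fun k => PosSemidef.isSymm_real (hV k).1)
    (fun x => antitone_nat_of_succ_le fun k => by
      rw [Function.iterate_succ_apply']; exact hf2 _ (hV k) x)
    (fun x => ⟨0, by rintro _ ⟨k, rfl⟩; exact (posSemidef_iff_real.1 (hV k).1).2 x⟩)
  refine ⟨_, L, hV, hL, hLs, fun x u => ?_⟩
  have hc1 : Continuous fun W : Matrix (Fin n) (Fin n) ℝ => x ⬝ᵥ W *ᵥ x := by fun_prop
  have hc2 : Continuous fun W : Matrix (Fin n) (Fin n) ℝ =>
      (x ⬝ᵥ W *ᵥ x + Sum.elim x u ⬝ᵥ qMat A B C D Q R W *ᵥ Sum.elim x u) / 2 := by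
    unfold qMat
    fun_prop
  -- The limit of P_{k+1} ≤ (P_k + q_{P_k})/2 is L ≤ (L + q_L)/2, that is, L ≤ q_L.
  have h1 := le_of_tendsto_of_tendsto'
    ((hc1.tendsto L).comp ((tendsto_add_atTop_iff_nat 1).2 hL)) ((hc2.tendsto L).comp hL)
    fun k => by
      simp only [Function.comp_apply, Function.iterate_succ_apply']
      exact hf3 _ (hV k) x u
  linarith

end Bellman

/-! ### Weak and strong duality -/

section Duality

variable {n m : ℕ} {A : Matrix (Fin n) (Fin n) ℝ} {B : Matrix (Fin n) (Fin m) ℝ}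
  {C : Matrix (Fin n) (Fin n) ℝ} {D : Matrix (Fin n) (Fin m) ℝ}
  {Q : Matrix (Fin n) (Fin n) ℝ} {R : Matrix (Fin m) (Fin m) ℝ}
  {Z : Matrix (Fin n) (Fin n) ℝ}

/-- Every term factors through [I; F], which reduces the augmented equation to an n × n Lyapunov
equation for the middle factor. -/
theorem lyapRhs_eq_congr (F : Matrix (Fin m) (Fin n) ℝ)
    (S : Matrix (Fin n ⊕ Fin m) (Fin n ⊕ Fin m) ℝ) :
    lyapRhs A B C D Z F S = feedbackMat F * (fromCols A B * S * (fromCols A B)ᵀ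
      + fromCols C D * S * (fromCols C D)ᵀ + Z) * (feedbackMat F)ᵀ := by
  simp only [lyapRhs, augMat_eq_mul, transpose_mul, Matrix.mul_add, Matrix.add_mul,
    Matrix.mul_assoc]
  rfl

theorem fromCols_congr_feedbackMat (F : Matrix (Fin m) (Fin n) ℝ) (Y : Matrix (Fin n) (Fin n) ℝ) :
    fromCols A B * (feedbackMat F * Y * (feedbackMat F)ᵀ) * (fromCols A B)ᵀ
      = (A + B * F) * Y * (A + B * F)ᵀ := by
  rw [← fromCols_mul_feedbackMat A B F]
  simp only [transpose_mul, Matrix.mul_assoc]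

theorem posSemidef_of_lyapRhs_eq {F : Matrix (Fin m) (Fin n) ℝ}
    (hF : IsStablePair (A + B * F) (C + D * F)) (hZ : Z.PosSemidef)
    {S : Matrix (Fin n ⊕ Fin m) (Fin n ⊕ Fin m) ℝ} (hS : S.IsSymm)
    (h : lyapRhs A B C D Z F S = S) : S.PosSemidef := by
  rw [lyapRhs_eq_congr] at h
  set Y := fromCols A B * S * (fromCols A B)ᵀ + fromCols C D * S * (fromCols C D)ᵀ + Z with hY
  have hYs : Y.IsSymm := by
    refine (IsSymm.add ?_ ?_).add (PosSemidef.isSymm_real hZ)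
    · simpa using isSymm_congr hS (fromCols A B)ᵀ
    · simpa using isSymm_congr hS (fromCols C D)ᵀ
  have hYZ : lyapOp (A + B * F) (C + D * F) Y + Z = Y := by
    rw [lyapOp_apply, ← fromCols_congr_feedbackMat, ← fromCols_congr_feedbackMat, h]
  rw [← h]
  have := (hF.posSemidef_of_lyapOp_add hYs hZ hYZ).mul_mul_conjTranspose_same (feedbackMat F)
  rwa [conjTranspose_eq_transpose_of_trivial] at this

/-- Take S = [I; F] Y [I; F]' with Y the closed-loop Gramian. Pairing Y with the Riccati inequality
bounds the cost by Tr((Y - UY)P) = Tr(ZP). -/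
theorem exists_feasible_trace_le {F : Matrix (Fin m) (Fin n) ℝ}
    (hF : IsStablePair (A + B * F) (C + D * F)) (hQ : Q.IsSymm) (hR : R.IsSymm)
    (hZ : Z.PosSemidef) {P : Matrix (Fin n) (Fin n) ℝ} (hP : P.IsSymm)
    (hPF : ∀ x, Sum.elim x (F *ᵥ x) ⬝ᵥ qMat A B C D Q R P *ᵥ Sum.elim x (F *ᵥ x)
      ≤ x ⬝ᵥ P *ᵥ x) :
    ∃ S : Matrix (Fin n ⊕ Fin m) (Fin n ⊕ Fin m) ℝ, S.IsSymm ∧ lyapRhs A B C D Z F S = S ∧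
      (costMat Q R * S).trace ≤ (Z * P).trace := by
  obtain ⟨Y, hY, hYZ⟩ := hF.exists_gramian hZ
  refine ⟨feedbackMat F * Y * (feedbackMat F)ᵀ, ?_, ?_, ?_⟩
  · simpa using isSymm_congr (PosSemidef.isSymm_real hY) (feedbackMat F)ᵀ
  · rw [lyapRhs_eq_congr, fromCols_congr_feedbackMat, fromCols_congr_feedbackMat, ← lyapOp_apply, hYZ]
  · have hX := qMat_isSymm A B C D hQ hR hP
    have h1 : (P - (feedbackMat F)ᵀ * qMat A B C D Q R P * feedbackMat F).PosSemidef := by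
      refine (posSemidef_sub_iff_real hP (isSymm_congr hX _)).2 fun x => ?_
      rw [dotProduct_congr_mulVec, feedbackMat_mulVec]
      exact hPF x
    have h2 := PosSemidef.trace_mul_le_real hY h1
    rw [congr_qMat, Matrix.mul_add, trace_add, ← trace_lyapOp_mul, eq_sub_of_add_eq hYZ,
      Matrix.sub_mul, trace_sub] at h2
    have h3 : (costMat Q R * (feedbackMat F * Y * (feedbackMat F)ᵀ)).trace
        = (Y * ((feedbackMat F)ᵀ * costMat Q R * feedbackMat F)).trace := by
      rw [← Matrix.mul_assoc, trace_mul_comm, ← Matrix.mul_assoc, ← Matrix.mul_assoc,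
        trace_mul_comm, ← Matrix.mul_assoc]
    linarith

/-- For this multiplier the Lagrangian equals Tr(ZP) + Tr(W([I; F]'X[I; F] - P)). Both factors of
the last trace are positive semidefinite, the second by the subsolution inequality at u = Fx. -/
theorem trace_le_lagrangian (hQ : Q.IsSymm) (hR : R.IsSymm) (hZ : Z.PosSemidef)
    {P : Matrix (Fin n) (Fin n) ℝ} (hP : P.IsSymm)
    (hsub : ∀ x u, x ⬝ᵥ P *ᵥ x ≤ Sum.elim x u ⬝ᵥ qMat A B C D Q R P *ᵥ Sum.elim x u)
    (F : Matrix (Fin m) (Fin n) ℝ) {S : Matrix (Fin n ⊕ Fin m) (Fin n ⊕ Fin m) ℝ}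
    (hS : S.PosSemidef) :
    (Z * P).trace ≤ lagrangian A B C D Q R Z (qMat A B C D Q R P) F S := by
  have hX := qMat_isSymm A B C D hQ hR hP
  set X := qMat A B C D Q R P with hXdef
  set W := fromCols A B * S * (fromCols A B)ᵀ + fromCols C D * S * (fromCols C D)ᵀ + Z with hW
  have hWp : W.PosSemidef := by
    have h := ((hS.mul_mul_conjTranspose_same (fromCols A B)).add
      (hS.mul_mul_conjTranspose_same (fromCols C D))).add hZ
    simpa only [conjTranspose_eq_transpose_of_trivial] using h
  have h1 : ((feedbackMat F)ᵀ * X * feedbackMat F - P).PosSemidef := by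
    refine (posSemidef_sub_iff_real (isSymm_congr hX _) hP).2 fun x => ?_
    rw [dotProduct_congr_mulVec, feedbackMat_mulVec]
    exact hsub x _
  have h2 := PosSemidef.trace_mul_le_real hWp h1
  have h3 : (lyapRhs A B C D Z F S * X).trace
      = (W * ((feedbackMat F)ᵀ * X * feedbackMat F)).trace := by
    rw [lyapRhs_eq_congr, ← hW, Matrix.mul_assoc, Matrix.mul_assoc, trace_mul_comm]
    simp only [Matrix.mul_assoc]
  have key : ∀ V : Matrix (Fin n) (Fin n ⊕ Fin m) ℝ,
      (V * S * Vᵀ * P).trace = (S * (Vᵀ * P * V)).trace := by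
    intro V
    rw [Matrix.mul_assoc, Matrix.mul_assoc, trace_mul_comm, Matrix.mul_assoc]
  have h4 : (S * X).trace
      = (costMat Q R * S).trace + ((W * P).trace - (Z * P).trace) := by
    rw [hXdef, qMat, hW]
    simp only [Matrix.mul_add, Matrix.add_mul, trace_add, key, trace_mul_comm S (costMat Q R)]
    ring
  rw [lagrangian, Matrix.sub_mul, trace_sub, h3, h4]
  linarith

variable {Ω : Type*} [MeasurableSpace Ω] {μ : Measure Ω} [IsProbabilityMeasure μ]
  {w : ℕ → Ω → ℝ}

theorem dualValue_le_primalValue (hw : IsNoise μ w) (hZ : Z.PosSemidef) :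
    dualValue μ w A B C D Q R Z ≤ primalValue μ w A B C D Q R Z := by
  refine iSup₂_le fun X _ => le_iInf fun S => le_iInf fun F => le_iInf fun h => ?_
  obtain ⟨hS, hSF, hF⟩ := h
  have hSp := posSemidef_of_lyapRhs_eq ((hw.isASMS_iff _ _).1 hF) hZ hS hSF
  refine iInf_le_of_le S (iInf_le_of_le F (iInf_le_of_le ⟨hSp, hF⟩ ?_))
  simp [lagrangian, hSF]

theorem primalValue_le_trace (hw : IsNoise μ w) (hQ : Q.PosSemidef) (hR : R.PosDef)
    (hZ : Z.PosSemidef) {P : Matrix (Fin n) (Fin n) ℝ}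
    (hP : IsStrictSupersolution A B C D Q R P) :
    primalValue μ w A B C D Q R Z ≤ ((Z * P).trace : ℝ) := by
  obtain ⟨hPp, F, c, hc, hPF⟩ := hP
  have hstable : IsStablePair (A + B * F) (C + D * F) := by
    refine isStablePair_of_lyapunov hPp hc fun x => ?_
    have h1 := hPF x
    have h2 := (posSemidef_iff_real.1 hQ).2 x
    have h3 := (posSemidef_iff_real.1 hR.posSemidef).2 (F *ᵥ x)
    rw [dotProduct_qMat] at h1
    simp only [dotProduct_lyapOp_transpose, add_mulVec, ← mulVec_mulVec]
    linarith
  obtain ⟨S, hS, hSF, hle⟩ := exists_feasible_trace_le hstable (PosSemidef.isSymm_real hQ)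
    (PosSemidef.isSymm_real hR.posSemidef) hZ (PosSemidef.isSymm_real hPp) fun x => by
      linarith [hPF x, mul_nonneg hc.le (dotProduct_self_nonneg_real x)]
  exact iInf_le_of_le S (iInf_le_of_le F (iInf_le_of_le
    ⟨hS, hSF, (hw.isASMS_iff _ _).2 hstable⟩ (EReal.coe_le_coe_iff.2 hle)))

/-- Starting point of the iteration: a Lyapunov matrix dominating the running cost under F, with
margin c = 1. -/
theorem IsStablePair.exists_strictSupersolution {F : Matrix (Fin m) (Fin n) ℝ}
    (h : IsStablePair (A + B * F) (C + D * F)) :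
    ∃ P, IsStrictSupersolution A B C D Q R P := by
  obtain ⟨P, hP, hPx⟩ := h.exists_lyapunov ((feedbackMat F)ᵀ * costMat Q R * feedbackMat F)
  refine ⟨P, hP, F, 1, one_pos, fun x => ?_⟩
  have h1 := hPx x
  rw [add_assoc, ← dotProduct_add, ← add_mulVec, ← congr_qMat, dotProduct_congr_mulVec,
    feedbackMat_mulVec] at h1
  rwa [one_mul]

theorem primalValue_eq_dualValue (hw : IsNoise μ w) (hQ : Q.PosSemidef) (hR : R.PosDef)
    (hstab : IsStabilizable μ w A B C D) (hZ : Z.PosSemidef) :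
    primalValue μ w A B C D Q R Z = dualValue μ w A B C D Q R Z := by
  refine le_antisymm ?_ (dualValue_le_primalValue hw hZ)
  obtain ⟨F, hF⟩ := hstab
  obtain ⟨P₀, hP₀⟩ :=
    IsStablePair.exists_strictSupersolution (Q := Q) (R := R) ((hw.isASMS_iff _ _).1 hF)
  obtain ⟨P, L, hP, hL, hLs, hsub⟩ := exists_subsolution_tendsto hQ hR hP₀
  have hQs := PosSemidef.isSymm_real hQ
  have hRs := PosSemidef.isSymm_real hR.posSemidef
  have hc : Continuous fun V : Matrix (Fin n) (Fin n) ℝ => (((Z * V).trace : ℝ) : EReal) :=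
    continuous_coe_real_ereal.comp (by fun_prop)
  calc primalValue μ w A B C D Q R Z ≤ ((Z * L).trace : ℝ) :=
        ge_of_tendsto' ((hc.tendsto L).comp hL) fun k => primalValue_le_trace hw hQ hR hZ (hP k)
    _ ≤ dualFun μ w A B C D Q R Z (qMat A B C D Q R L) :=
        le_iInf fun S => le_iInf fun F => le_iInf fun h =>
          EReal.coe_le_coe_iff.2 (trace_le_lagrangian hQs hRs hZ hLs hsub F h.1)
    _ ≤ dualValue μ w A B C D Q R Z :=
        le_iSup₂_of_le (qMat A B C D Q R L) (qMat_isSymm A B C D hQs hRs hLs) le_rfl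

end Duality

end SLQR

theorem mainTheorem3 {Ω : Type*} [MeasurableSpace Ω] (μ : Measure Ω) [IsProbabilityMeasure μ]
    (w : ℕ → Ω → ℝ) (hw : SLQR.IsNoise μ w) {n m r : ℕ}
    (A : Matrix (Fin n) (Fin n) ℝ) (B : Matrix (Fin n) (Fin m) ℝ)
    (C : Matrix (Fin n) (Fin n) ℝ) (D : Matrix (Fin n) (Fin m) ℝ)
    (Q : Matrix (Fin n) (Fin n) ℝ) (R : Matrix (Fin m) (Fin m) ℝ)
    (hQ : Q.PosSemidef) (hR : R.PosDef)
    (hstab : SLQR.IsStabilizable μ w A B C D)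
    (hdet : SLQR.IsExactlyObservable μ w A C Q ∨ SLQR.IsExactlyDetectable μ w A C Q)
    (z : Fin r → Fin n → ℝ) (hZ : (SLQR.initGram z).PosDef) :
    SLQR.primalValue μ w A B C D Q R (SLQR.initGram z) =
      SLQR.dualValue μ w A B C D Q R (SLQR.initGram z) := by
  exact SLQR.primalValue_eq_dualValue hw hQ hR hstab hZ.posSemidef
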